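/- Let $K$ be an infinite field and let $G=(V,E)$ be a finite simple graph with vertex set $V=\{1,\dots,n\}$. Let $S=K[x_1,\dots,x_n,y_1,\dots,y_n]$, let $\mathfrak m=(x_1,\dots,x_n,y_1,\dots,y_n)$, and let $J_G=(x_iy_j-x_jy_i \mid \{i,j\}\in E)\subset S$ be the binomial edge ideal of $G$. The analytic spread $\ell(J_G)$ is the Krull dimension of the special fiber ring $S[J_Gt]/\mathfrak m S[J_Gt]$, where $S[J_Gt]=\bigoplus_{k\ge 0}J_G^k t^k$ is the Rees algebra of $J_G$. If $G$ is connected and every vertex of $G$ has degree at least $4$, then $$\ell(J_G)\le |E|-3.$$ -/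

import Mathlib

/-- The binomial edge ideal `J_G = (x_i y_j - x_j y_i | {i, j} ∈ E(G))` of a graph `G` on `V`, in the
polynomial ring over `K` with variables `x_i = X (Sum.inl i)` and `y_i = X (Sum.inr i)`, `i ∈ V`. -/
noncomputable def binomialEdgeIdeal (K : Type*) [Field K] {V : Type*} (G : SimpleGraph V) :
    Ideal (MvPolynomial (V ⊕ V) K) :=
  Ideal.span {f | ∃ i j : V, G.Adj i j ∧
    f = MvPolynomial.X (Sum.inl i) * MvPolynomial.X (Sum.inr j)
      - MvPolynomial.X (Sum.inl j) * MvPolynomial.X (Sum.inr i)}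

/-- The homogeneous maximal ideal `𝔪` generated by all the variables of a polynomial ring. -/
noncomputable def variablesIdeal (σ K : Type*) [Field K] : Ideal (MvPolynomial σ K) :=
  Ideal.span (Set.range MvPolynomial.X)

/-- The special fiber ring `F(I) = R[It] / 𝔪 R[It]` of an ideal `I` of a polynomial ring `R`,
where `R[It] = ⨁ Iᵏ tᵏ` is the Rees algebra of `I`. -/
abbrev specialFiberRing {σ K : Type*} [Field K] (I : Ideal (MvPolynomial σ K)) : Type _ :=
  reesAlgebra I ⧸ (variablesIdeal σ K).map (algebraMap (MvPolynomial σ K) (reesAlgebra I))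

/-- The analytic spread `ℓ(I) = dim F(I)`: the Krull dimension of the special fiber ring. -/
noncomputable def analyticSpread {σ K : Type*} [Field K] (I : Ideal (MvPolynomial σ K)) :
    WithBot ℕ∞ :=
  ringKrullDim (specialFiberRing I)

/-!
The fibre ring of an ideal generated by forms `f_e` of one degree is a quotient of the `K`-algebra
`K[f_e t] ⊆ S[t]`, since the Rees algebra is generated over `S` by the `f_e t` and `S` acts on the
fibre ring through `S / 𝔪 = K`. For a binomial edge ideal the `f_e` are maximal minors
`p_{ij} = x_i y_j - x_j y_i` of a generic `2 × n` matrix. Fix two vertices `a ≠ b`. The Plücker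
relation `p_{ab} p_{ij} = p_{ai} p_{bj} - p_{aj} p_{bi}` shows that every `p_{ij} t` is algebraic
over the subalgebra generated by the elements `p_{aj} t` with `j ≠ a` and `p_{bj} t` with
`j ≠ a, b`, of which there are at most `2n - 3`. Noether normalization bounds the Krull dimension of
`K[f_e t]` by this number, so that `ℓ(J_G) ≤ 2n - 3` for every graph on `n ≥ 2` vertices. If all
degrees are at least `4`, then `|E| ≥ 2n` by the handshake lemma.
-/

/-- A subalgebra of a domain generated by finitely many elements that are algebraic over `K[T]` has
Krull dimension at most `|T|`: by Noether normalization it is integral over a polynomial ring, whose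
variables form a set that is independent in the matroid of algebraic independence and that lies in
the closure of `T`. -/
theorem ringKrullDim_adjoin_le_card {K L : Type*} [Field K] [CommRing L] [IsDomain L] [Algebra K L]
    {P : Set L} (hP : P.Finite) (T : Finset L)
    (hPT : ∀ p ∈ P, IsAlgebraic (Algebra.adjoin K (T : Set L)) p) :
    ringKrullDim (Algebra.adjoin K P) ≤ (T.card : WithBot ℕ∞) := by
  have : Algebra.FiniteType K (Algebra.adjoin K P) :=
    (Subalgebra.fg_iff_finiteType _).mp (Subalgebra.fg_def.mpr ⟨P, hP, rfl⟩)
  obtain ⟨s, g, hg, hint⟩ := exists_integral_inj_algHom_of_fg K (Algebra.adjoin K P)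
  have hdim : ringKrullDim (Algebra.adjoin K P) ≤ s := by
    algebraize [g.toRingHom]
    have : Algebra.IsIntegral (MvPolynomial (Fin s) K) (Algebra.adjoin K P) := ⟨hint⟩
    have h : ringKrullDim (Algebra.adjoin K P) ≤ ringKrullDim (MvPolynomial (Fin s) K) :=
      Order.krullDim_le_of_strictMono
        (PrimeSpectrum.comap (algebraMap (MvPolynomial (Fin s) K) (Algebra.adjoin K P)))
        fun _ _ hIJ ↦ Ideal.IsIntegral.comap_lt_comap hIJ
    simpa [MvPolynomial.ringKrullDim_of_isNoetherianRing] using h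
  refine hdim.trans ?_
  let z : Fin s → L := fun i ↦ (g (MvPolynomial.X i) : L)
  have hz : AlgebraicIndependent K z := by
    have h1 : AlgebraicIndependent K fun i ↦ g (MvPolynomial.X i) :=
      (MvPolynomial.algebraicIndependent_X (Fin s) K).map' hg
    exact h1.map' (f := (Algebra.adjoin K P).val) Subtype.val_injective
  have hsub : Set.range z ⊆ (AlgebraicIndependent.matroid K L).closure T := by
    rw [AlgebraicIndependent.matroid_closure_eq]
    have hle : Algebra.adjoin K P ≤
        (Subalgebra.algebraicClosure (Algebra.adjoin K (T : Set L)) L).restrictScalars K :=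
      Algebra.adjoin_le hPT
    rintro _ ⟨i, rfl⟩
    exact hle (g (MvPolynomial.X i)).2
  have hind : (AlgebraicIndependent.matroid K L).Indep (Set.range z) :=
    AlgebraicIndependent.matroid_indep_iff.mpr hz.coe_range
  have hcard := (hind.encard_le_eRk_of_subset hsub).trans
    ((Matroid.eRk_closure_eq _ _).trans_le (Matroid.eRk_le_encard _ _))
  rw [← Set.image_univ, hz.injective.encard_image, Set.encard_univ,
    Set.encard_coe_eq_coe_finsetCard] at hcard
  simp only [ENat.card_eq_coe_fintype_card, Fintype.card_fin] at hcard
  exact_mod_cast hcard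

section Fiber

variable {σ K : Type*} [Field K]

open Polynomial in
/-- If `I` is spanned by `F`, the `K`-subalgebra generated by the degree-one elements `f t`, `f ∈ F`,
of the Rees algebra maps onto the special fiber ring. -/
theorem ringKrullDim_specialFiberRing_span_le (F : Set (MvPolynomial σ K)) :
    ringKrullDim (specialFiberRing (Ideal.span F)) ≤
      ringKrullDim (Algebra.adjoin K
        ((monomial 1 : MvPolynomial σ K →ₗ[MvPolynomial σ K] (MvPolynomial σ K)[X]) '' F)) := by
  set I := Ideal.span F
  set P := (monomial 1 : MvPolynomial σ K →ₗ[MvPolynomial σ K] (MvPolynomial σ K)[X]) '' F with hPdef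
  have hP : ∀ p ∈ P, p ∈ reesAlgebra I := by
    rintro _ ⟨f, hf, rfl⟩
    exact reesAlgebra.monomial_mem.mpr (by simpa using Ideal.subset_span hf)
  have hle : Algebra.adjoin K P ≤ (reesAlgebra I).restrictScalars K := Algebra.adjoin_le hP
  let 𝔪 := (variablesIdeal σ K).map (algebraMap (MvPolynomial σ K) (reesAlgebra I))
  let φ : Algebra.adjoin K P →+* specialFiberRing I :=
    (Ideal.Quotient.mk 𝔪).comp (Subalgebra.inclusion hle).toRingHom
  have hφ : ∀ (f : (MvPolynomial σ K)[X]) (hf : f ∈ Algebra.adjoin K P),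
      φ ⟨f, hf⟩ = Ideal.Quotient.mk 𝔪 ⟨f, hle hf⟩ := fun _ _ ↦ rfl
  have hrees : Algebra.adjoin (MvPolynomial σ K) P = reesAlgebra I := by
    rw [← adjoin_monomial_eq_reesAlgebra, ← Algebra.adjoin_span, hPdef, ← Submodule.map_span]
  refine ringKrullDim_le_of_surjective φ fun y ↦ ?_
  obtain ⟨⟨f, hf⟩, rfl⟩ := Ideal.Quotient.mk_surjective y
  have hf' := hf
  rw [← hrees] at hf'
  suffices h : ∃ hf : f ∈ reesAlgebra I, ∃ a, φ a = Ideal.Quotient.mk 𝔪 ⟨f, hf⟩ from h.2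
  clear hf
  induction hf' using Algebra.adjoin_induction with
  | mem p hp => exact ⟨hP p hp, ⟨p, Algebra.subset_adjoin hp⟩, rfl⟩
  | algebraMap r =>
    refine ⟨(reesAlgebra I).algebraMap_mem r, ?_⟩
    change ∃ a, φ a = Ideal.Quotient.mk 𝔪 (algebraMap _ _ r)
    induction r using MvPolynomial.induction_on with
    | C c => exact ⟨algebraMap K _ c, rfl⟩
    | add r s hr hs =>
      obtain ⟨a, ha⟩ := hr
      obtain ⟨b, hb⟩ := hs
      exact ⟨a + b, by rw [map_add, map_add, map_add, ha, hb]⟩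
    | mul_X r i _ =>
      -- Variables vanish in the special fiber ring, so only constant terms of `r` survive.
      refine ⟨0, ?_⟩
      rw [map_zero, eq_comm, Ideal.Quotient.eq_zero_iff_mem]
      exact Ideal.mem_map_of_mem _ (Ideal.mul_mem_left _ _ (Ideal.subset_span ⟨i, rfl⟩))
  | add f g _ _ ihf ihg =>
    obtain ⟨hf, a, ha⟩ := ihf
    obtain ⟨hg, b, hb⟩ := ihg
    exact ⟨add_mem hf hg, a + b, by rw [map_add, ha, hb, ← map_add]; rfl⟩
  | mul f g _ _ ihf ihg =>
    obtain ⟨hf, a, ha⟩ := ihf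
    obtain ⟨hg, b, hb⟩ := ihg
    exact ⟨mul_mem hf hg, a * b, by rw [map_mul, ha, hb, ← map_mul]; rfl⟩

end Fiber

section Plucker

variable (K : Type*) [Field K] {V : Type*}

/-- The `2 × 2` minor `x_i y_j - x_j y_i` of the generic `2 × V` matrix, placed in degree one of the
Rees algebra, that is, multiplied by `t`. -/
noncomputable def gradedMinor (i j : V) : Polynomial (MvPolynomial (V ⊕ V) K) :=
  Polynomial.monomial 1 (MvPolynomial.X (Sum.inl i) * MvPolynomial.X (Sum.inr j)
    - MvPolynomial.X (Sum.inl j) * MvPolynomial.X (Sum.inr i))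

theorem gradedMinor_self (i : V) : gradedMinor K i i = 0 := by
  simp [gradedMinor]

theorem gradedMinor_swap (i j : V) : gradedMinor K j i = -gradedMinor K i j := by
  rw [gradedMinor, gradedMinor, ← map_neg, neg_sub]

theorem gradedMinor_ne_zero {i j : V} (hij : i ≠ j) : gradedMinor K i j ≠ 0 := by
  classical
  rw [gradedMinor, Ne, Polynomial.monomial_eq_zero_iff]
  intro h
  -- Evaluate at `x_i = y_j = 1`, all other variables being `0`.
  have := congrArg (MvPolynomial.eval (Sum.elim (Pi.single i (1 : K)) (Pi.single j (1 : K)))) h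
  simp [hij] at this

theorem gradedMinor_mul_gradedMinor (a b i j : V) :
    gradedMinor K a b * gradedMinor K i j =
      gradedMinor K a i * gradedMinor K b j - gradedMinor K a j * gradedMinor K b i := by
  simp only [gradedMinor, Polynomial.monomial_mul_monomial, ← map_sub]
  congr 1
  ring

/-- The nonzero minors involving column `a` or column `b`, each taken once up to sign; for `a ≠ b`
there are `2n - 3` of them. -/
noncomputable def pencilMinors [Fintype V] (a b : V) :
    Finset (Polynomial (MvPolynomial (V ⊕ V) K)) :=
  open scoped Classical in
  (Finset.univ.erase a).image (gradedMinor K a) ∪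
    ((Finset.univ.erase a).erase b).image (gradedMinor K b)

theorem card_pencilMinors_add_three_le [Fintype V] {a b : V} (hab : a ≠ b) :
    (pencilMinors K a b).card + 3 ≤ 2 * Fintype.card V := by
  classical
  have hU : (pencilMinors K a b).card ≤
      (Finset.univ.erase a).card + ((Finset.univ.erase a).erase b).card := by
    unfold pencilMinors
    refine (Finset.card_union_le _ _).trans (add_le_add ?_ ?_) <;>
    · convert Finset.card_image_le
  rw [Finset.card_erase_of_mem (a := b) (by simp [hab.symm]),
    Finset.card_erase_of_mem (Finset.mem_univ a), Finset.card_univ] at hU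
  have : 2 ≤ Fintype.card V := Fintype.one_lt_card_iff.mpr ⟨a, b, hab⟩
  omega

/-- The `K`-algebra generated by the minors involving column `a` or column `b`. -/
noncomputable abbrev pencilAlgebra [Fintype V] (a b : V) :
    Subalgebra K (Polynomial (MvPolynomial (V ⊕ V) K)) :=
  Algebra.adjoin K (pencilMinors K a b : Set (Polynomial (MvPolynomial (V ⊕ V) K)))

theorem gradedMinor_left_mem_pencilAlgebra [Fintype V] (a b j : V) :
    gradedMinor K a j ∈ pencilAlgebra K a b := by
  classical
  by_cases hj : j = a
  · rw [hj, gradedMinor_self]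
    exact zero_mem _
  have h : gradedMinor K a j ∈ pencilMinors K a b :=
    Finset.mem_union_left _ (Finset.mem_image_of_mem _ (by simp [hj]))
  exact Algebra.subset_adjoin h

theorem gradedMinor_right_mem_pencilAlgebra [Fintype V] (a b j : V) :
    gradedMinor K b j ∈ pencilAlgebra K a b := by
  classical
  by_cases hja : j = a
  · rw [hja, gradedMinor_swap]
    exact neg_mem (gradedMinor_left_mem_pencilAlgebra K a b b)
  by_cases hjb : j = b
  · rw [hjb, gradedMinor_self]
    exact zero_mem _
  have h : gradedMinor K b j ∈ pencilMinors K a b :=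
    Finset.mem_union_right _ (Finset.mem_image_of_mem _ (by simp [hja, hjb]))
  exact Algebra.subset_adjoin h

theorem isAlgebraic_gradedMinor [Fintype V] {a b : V} (hab : a ≠ b) (i j : V) :
    IsAlgebraic (pencilAlgebra K a b) (gradedMinor K i j) := by
  have halg : ∀ z ∈ pencilAlgebra K a b, IsAlgebraic (pencilAlgebra K a b) z :=
    fun z hz ↦ isAlgebraic_algebraMap (⟨z, hz⟩ : pencilAlgebra K a b)
  have hl := gradedMinor_left_mem_pencilAlgebra K a b
  have hr := gradedMinor_right_mem_pencilAlgebra K a b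
  refine IsAlgebraic.of_mul (mem_nonZeroDivisors_of_ne_zero (gradedMinor_ne_zero K hab))
    (halg _ (hl b)) (halg _ ?_)
  rw [gradedMinor_mul_gradedMinor]
  exact sub_mem (mul_mem (hl i) (hr j)) (mul_mem (hl j) (hr i))

/-- The analytic spread of a binomial edge ideal is at most the dimension `2n - 3` of the coordinate
ring of the Grassmannian of lines, the algebra of all maximal minors. -/
theorem analyticSpread_binomialEdgeIdeal_add_three_le [Fintype V] (hV : 1 < Fintype.card V)
    (G : SimpleGraph V) :
    analyticSpread (binomialEdgeIdeal K G) + 3 ≤ ((2 * Fintype.card V : ℕ) : WithBot ℕ∞) := by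
  obtain ⟨a, b, hab⟩ := Fintype.one_lt_card_iff.mp hV
  have hfin := Set.finite_range fun p : V × V ↦ gradedMinor K p.1 p.2
  have hdim := (ringKrullDim_specialFiberRing_span_le {f | ∃ i j : V, G.Adj i j ∧
    f = MvPolynomial.X (Sum.inl i) * MvPolynomial.X (Sum.inr j)
      - MvPolynomial.X (Sum.inl j) * MvPolynomial.X (R := K) (Sum.inr i)}).trans
    (ringKrullDim_adjoin_le_card (hfin.subset ?_) (pencilMinors K a b) ?_)
  · calc analyticSpread (binomialEdgeIdeal K G) + 3
        ≤ ((pencilMinors K a b).card : WithBot ℕ∞) + 3 := by gcongr; exact hdim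
      _ ≤ _ := by exact_mod_cast card_pencilMinors_add_three_le K hab
  · rintro _ ⟨_, ⟨i, j, _, rfl⟩, rfl⟩
    exact ⟨(i, j), rfl⟩
  · rintro _ ⟨_, ⟨i, j, _, rfl⟩, rfl⟩
    exact isAlgebraic_gradedMinor K hab i j

end Plucker

theorem SimpleGraph.card_mul_minDegree_le {V : Type*} [Fintype V] (G : SimpleGraph V)
    [DecidableRel G.Adj] : Fintype.card V * G.minDegree ≤ 2 * G.edgeFinset.card := by
  rw [← G.sum_degrees_eq_twice_card_edges, ← smul_eq_mul]
  exact Finset.card_nsmul_le_sum _ _ _ fun v _ ↦ G.minDegree_le_degree v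

theorem corollary4p6 {K : Type*} [Field K] [Infinite K] {V : Type*} [Fintype V] [DecidableEq V]
    (G : SimpleGraph V) [DecidableRel G.Adj] (hconn : G.Connected) (hdeg : 4 ≤ G.minDegree) :
    analyticSpread (binomialEdgeIdeal K G) + 3 ≤ (G.edgeFinset.card : WithBot ℕ∞) := by
  have hE : 2 * Fintype.card V ≤ G.edgeFinset.card := by
    have := G.card_mul_minDegree_le
    have := Nat.mul_le_mul_left (Fintype.card V) hdeg
    omega
  have hV : 1 < Fintype.card V := by
    obtain ⟨v⟩ := hconn.nonempty
    have := G.minDegree_le_degree v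
    have := G.degree_lt_card_verts v
    omega
  exact (analyticSpread_binomialEdgeIdeal_add_three_le K hV G).trans (by exact_mod_cast hE)
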